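/- Let $\varphi=\frac{1+\sqrt5}{2}$ and let $\Pi$ be a non-empty set of permutations of $[n]=\{1,\dots,n\}$. Let $X_1,\dots,X_n$ be independent non-negative random variables with known distributions, accompanied by auxiliary random variables $\tilde X_1,\dots,\tilde X_n$, uniform on $[0,1]$, independent of one another and of $X_1,\dots,X_n$, which may be used for tie-breaking. A threshold stopping rule for $\pi\in\Pi$ with threshold $\theta\in\mathbb{R}$ is a stopping rule adapted to the sequence of pairs $(X_{\pi(1)},\tilde X_{\pi(1)}),\dots,(X_{\pi(n)},\tilde X_{\pi(n)})$ that never selects a value $X_{\pi(i)}<\theta$ and never passes over a value $X_{\pi(i)}>\theta$ (its behavior at values equal to $\theta$ is unconstrained); its reward is the selected value, or $0$ if no value is selected. The threshold prophet ratio $\mathsf{TPR}(\Pi)$ is the supremum of all $\alpha\ge 0$ such that for every $n$-tuple of distributions of $X_1,\dots,X_n$ on $[0,\infty)$ there are a permutation $\pi\in\Pi$ and a threshold stopping rule for $\pi$ whose expected reward is at least $\alpha\cdot\mathbb{E}\left[\max_{1\le i\le n}X_i\right]$. (1) If $n\ge 3$ and $|\Pi|<\sqrt{\log_2 n}$, then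 $\mathsf{TPR}(\Pi)\le\varphi^{-1}$. (2) There is an absolute constant $C>0$ such that for every $\varepsilon>0$ with $\varepsilon\neq 1$, every $n\ge 1$ and every non-empty set $\Pi$ of permutations of $[n]$: if $|\Pi|<\log_{1/\varepsilon} n$, then $\mathsf{TPR}(\Pi)\le\varphi^{-1}+C\varepsilon$. -/

import Mathlib

open MeasureTheory
open scoped NNReal ENNReal unitInterval

namespace ConstrainedOrderProphet

/-- A sample point: for every index `i`, the pair of the value `X i ≥ 0` and of the auxiliary
tie-breaking value in `[0, 1]`. -/
abbrev Sample (n : ℕ) : Type := Fin n → ℝ≥0 × I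

/-- The joint law of the sample when `D i` is the law of `X i`: the values `X i` are independent,
and the auxiliary values are independent of them and of one another, and uniform on `[0, 1]`. -/
noncomputable def sampleLaw {n : ℕ} (D : Fin n → Measure ℝ≥0) : Measure (Sample n) :=
  Measure.pi fun i => (D i).prod (volume : Measure I)

/-- The information available to a gambler who observes the indices in the order
`π 0, π 1, …`: at time `k`, the pairs with indices `π 0, …, π k`. -/
noncomputable def observed {n : ℕ} (π : Equiv.Perm (Fin n)) :
    Filtration (Fin n) (inferInstance : MeasurableSpace (Sample n)) :=
  Filtration.natural (fun k (ω : Sample n) => ω (π k))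
    (fun k => (measurable_pi_apply (π k)).stronglyMeasurable)

/-- `τ` is a threshold stopping rule with threshold `θ` for the order `π`. The value of `τ` is the
time at which the gambler stops, and `⊤` if no value is selected. The rule never selects a value
strictly less than `θ`, and never passes over a value strictly greater than `θ`; its behavior at
values equal to `θ` is unconstrained. -/
structure IsThresholdRule {n : ℕ} (π : Equiv.Perm (Fin n)) (θ : ℝ)
    (τ : Sample n → WithTop (Fin n)) : Prop where
  isStoppingTime : IsStoppingTime (observed π) τ
  ne_of_lt : ∀ (ω : Sample n) (k : Fin n), ((ω (π k)).1 : ℝ) < θ → τ ω ≠ (k : WithTop (Fin n))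
  le_of_gt : ∀ (ω : Sample n) (k : Fin n), θ < ((ω (π k)).1 : ℝ) → τ ω ≤ (k : WithTop (Fin n))

/-- The value selected in the order `π` when stopping at time `t`; it is `0` if no value is
selected. -/
def selectedValue {n : ℕ} (π : Equiv.Perm (Fin n)) (ω : Sample n) : WithTop (Fin n) → ℝ≥0
  | none => 0
  | some k => (ω (π k)).1

/-- The expected value of a gambler who uses the order `π` and the rule `τ`. -/
noncomputable def gamblerValue {n : ℕ} (D : Fin n → Measure ℝ≥0) (π : Equiv.Perm (Fin n))
    (τ : Sample n → WithTop (Fin n)) : ℝ≥0∞ :=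
  ∫⁻ ω, (selectedValue π ω (τ ω) : ℝ≥0∞) ∂(sampleLaw D)

/-- The expected value of the prophet, i.e. of the maximum of the `X i`. -/
noncomputable def prophetValue {n : ℕ} (D : Fin n → Measure ℝ≥0) : ℝ≥0∞ :=
  ∫⁻ ω, ⨆ i, ((ω i).1 : ℝ≥0∞) ∂(sampleLaw D)

/-- `S` satisfies a constrained-order threshold prophet inequality with factor `α`. -/
def SatisfiesThresholdProphet {n : ℕ} (S : Finset (Equiv.Perm (Fin n))) (α : ℝ≥0) : Prop :=
  ∀ D : Fin n → Measure ℝ≥0, (∀ i, IsProbabilityMeasure (D i)) →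
    ∃ π ∈ S, ∃ (θ : ℝ) (τ : Sample n → WithTop (Fin n)),
      IsThresholdRule π θ τ ∧ (α : ℝ≥0∞) * prophetValue D ≤ gamblerValue D π τ

/-- The threshold prophet ratio of `S`: the supremum of all factors `α` such that `S` satisfies a
constrained-order threshold prophet inequality with factor `α`. -/
noncomputable def TPR {n : ℕ} (S : Finset (Equiv.Perm (Fin n))) : ℝ≥0∞ :=
  ⨆ (α : ℝ≥0) (_ : SatisfiesThresholdProphet S α), (α : ℝ≥0∞)

end ConstrainedOrderProphet

/-! Write g = φ⁻¹, so g² = 1 - g. One index x carries a rare large value: 1/δ with probability 2gδ,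
contributing 2g in expectation. The other indices carry values near 1, whose maximum is 1 + δU with
U uniform, split according to weights μ. If u is the probability that none of them exceeds the
threshold and b is the μ-weight preceding x, a threshold rule gets about 1 - u + 2g·u^b. For b ≥ 1/2
this is at most 1 + g², against about 1 + 2g for the prophet. The ratio is g; a deficit η in b costs
at most 2η (`TPR_le_of_weights`).

It remains to find x and μ such that μ puts weight at least 1/2 - η before x in every order of Π. By
minimax, this holds if, for every weighting w of the orders, some y precedes x with w-weight at
least 1/2 - η (`TPR_le_of_forall_vote`). If no x works, each x has a weighting w_x under which every
y precedes x with weight below 1/2 - η. Two points with nearly equal weightings contradict each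
other, as one of x, y precedes the other in each order. Pigeonhole then bounds n.

For (1), weightings are classified by which sets of orders have weight below 1/2, and Sauer–Shelah
bounds the number of classes (`exists_forall_half_le`, η = 0). For (2), weightings are rounded to a
grid (`exists_forall_half_sub_le`). -/

namespace ConstrainedOrderProphet

/-! ### Finite minimax by convex separation -/

/-- The minimax theorem for finite matrix games, for the mixed strategies of the row player. -/
theorem exists_mem_stdSimplex_forall_le {ι Y : Type*} [Fintype ι] [Fintype Y] [Nonempty Y]
    (a : Y → ι → ℝ) (β : ℝ)
    (h : ∀ w ∈ stdSimplex ℝ ι, ∃ y, β ≤ ∑ l, w l * a y l) :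
    ∃ μ ∈ stdSimplex ℝ Y, ∀ l, β ≤ ∑ y, μ y * a y l := by
  classical
  by_contra! hcon
  let F : (Y → ℝ) →ₗ[ℝ] (ι → ℝ) := ∑ y, (LinearMap.proj y).smulRight (a y)
  have hF : ∀ μ l, F μ l = ∑ y, μ y * a y l := by
    intro μ l
    simp [F, Finset.sum_apply]
  have hFc : Continuous F := F.continuous_of_finiteDimensional
  obtain ⟨f, u, v, hf1, huv, hf2⟩ := geometric_hahn_banach_compact_closed
    (s := F '' stdSimplex ℝ Y) (t := Set.Ici (fun _ : ι => β))
    ((convex_stdSimplex ℝ Y).linear_image F) ((isCompact_stdSimplex ℝ Y).image hFc)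
    (convex_Ici _) isClosed_Ici (by
      rw [Set.disjoint_left]
      rintro _ ⟨μ, hμ, rfl⟩ ht
      obtain ⟨l, hl⟩ := hcon μ hμ
      have := ht l
      rw [hF] at this
      linarith)
  let c : ι → ℝ := fun l => f (Pi.single l 1)
  have hfc : ∀ x : ι → ℝ, f x = ∑ l, x l * c l := by
    intro x
    conv_lhs => rw [pi_eq_sum_univ' x]
    simp [map_sum, c]
  have hβ : f (fun _ => β) = β * ∑ l, c l := by
    rw [hfc, Finset.mul_sum]
  have hvβ := hf2 (fun _ => β) (Set.mem_Ici.2 le_rfl)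
  have hc0 : ∀ l, 0 ≤ c l := by
    intro l
    by_contra! hl
    -- A negative coefficient would let `f` descend along the `l`-th axis of the orthant; this
    -- multiple brings it exactly to `v`, against the strict separation.
    have hr : 0 ≤ (f (fun _ => β) - v) / (-c l) := div_nonneg (by linarith) (by linarith)
    have := hf2 ((fun _ => β) + ((f (fun _ => β) - v) / (-c l)) • Pi.single l 1) (by
      rw [Set.mem_Ici, le_add_iff_nonneg_right]
      exact smul_nonneg hr (Pi.single_nonneg.2 zero_le_one))
    rw [map_add, map_smul, smul_eq_mul] at this
    change v < _ + _ / (-c l) * c l at this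
    have h2 : (f (fun _ => β) - v) / (-c l) * c l = -(f (fun _ => β) - v) := by
      rw [div_neg, neg_mul, div_mul_cancel₀ _ hl.ne]
    rw [h2] at this
    linarith
  have hay : ∀ y, f (a y) < u := by
    intro y
    refine hf1 _ ⟨Pi.single y 1, single_mem_stdSimplex ℝ y, ?_⟩
    ext l
    rw [hF]
    simp [Pi.single_apply]
  have hpos : 0 < ∑ l, c l := by
    refine (Finset.sum_nonneg fun l _ => hc0 l).lt_of_ne' fun h0 => ?_
    have hz := (Finset.sum_eq_zero_iff_of_nonneg fun l _ => hc0 l).1 h0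
    have h1 := hay (Classical.arbitrary Y)
    rw [hfc, Finset.sum_eq_zero (fun l hl => by rw [hz l hl, mul_zero])] at h1
    rw [hβ, h0] at hvβ
    linarith
  -- The normalized separating functional is a mixed strategy that violates `h`.
  obtain ⟨y, hy⟩ := h (fun l => c l / ∑ l, c l)
    ⟨fun l => div_nonneg (hc0 l) hpos.le, by rw [← Finset.sum_div, div_self hpos.ne']⟩
  have h3 : ∑ l, c l / (∑ l, c l) * a y l = f (a y) / ∑ l, c l := by
    rw [hfc, Finset.sum_div]
    exact Finset.sum_congr rfl fun l _ => by ring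
  rw [h3, le_div_iff₀ hpos] at hy
  linarith [hay y]

/-! ### Exact majorities: counting weightings by sign patterns -/

/-- A family of sign patterns of linear functionals on `ι → ℝ` shatters no set with more than
`Fintype.card ι` elements. -/
theorem card_le_of_shatters_halfspaces {ι α V : Type*} [Fintype ι] [Fintype α] [DecidableEq α]
    [Fintype V] (w : V → ι → ℝ) (a : α → ι → ℝ) {s : Finset α}
    (hs : (Finset.univ.image fun v => Finset.univ.filter
      fun A => ∑ l, w v l * a A l < 0).Shatters s) : s.card ≤ Fintype.card ι := by
  by_contra! hcard
  have hdep : ¬ LinearIndependent ℝ (fun A : s => a A) := by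
    intro h
    have := h.fintype_card_le_finrank
    rw [Module.finrank_fintype_fun_eq_card, Fintype.card_coe] at this
    omega
  rw [Fintype.not_linearIndependent_iff] at hdep
  obtain ⟨g, hg, i, hi⟩ := hdep
  wlog hpos : 0 < g i generalizing g
  · refine this (fun A => - g A) ?_ (neg_ne_zero.2 hi) ?_
    · simp only [neg_smul, Finset.sum_neg_distrib, hg, neg_zero]
    · have : g i < 0 := lt_of_le_of_ne (not_lt.1 hpos) hi
      linarith
  -- Shattering realizes the positive support of the dependence as a negativity set. Every term of
  -- the vanishing sum is then nonpositive, and the term at `i` is negative.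
  obtain ⟨P, hP, hPs⟩ := hs (Finset.filter_subset (fun A => ∃ h : A ∈ s, 0 < g ⟨A, h⟩) s)
  rw [Finset.mem_image] at hP
  obtain ⟨v, -, rfl⟩ := hP
  have key : ∀ A : s, (∑ l, w v l * a A l < 0) ↔ 0 < g A := by
    intro A
    have := Finset.ext_iff.1 hPs A
    simpa using this
  have hsum : ∑ A : s, g A * ∑ l, w v l * a A l = 0 := by
    have h2 : ∑ l, w v l * (∑ A : s, g A • a A) l = 0 := by
      rw [hg]
      simp
    rw [← h2]
    simp only [Finset.sum_apply, Pi.smul_apply, smul_eq_mul, Finset.mul_sum]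
    rw [Finset.sum_comm]
    exact Finset.sum_congr rfl fun l _ => Finset.sum_congr rfl fun A _ => by ring
  have hneg : ∑ A : s, g A * ∑ l, w v l * a A l < ∑ A : s, 0 := by
    refine Finset.sum_lt_sum (fun A _ => ?_) ⟨i, Finset.mem_univ _, ?_⟩
    · by_cases h : 0 < g A
      · exact (mul_neg_of_pos_of_neg h ((key A).2 h)).le
      · exact mul_nonpos_of_nonpos_of_nonneg (not_lt.1 h) (not_lt.1 fun h' => h ((key A).1 h'))
    · exact mul_neg_of_pos_of_neg hpos ((key i).2 hpos)
  rw [hsum] at hneg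
  simp at hneg

theorem sum_choose_le_pow (N k : ℕ) : ∑ i ∈ Finset.Iic k, N.choose i ≤ (N + 1) ^ k := by
  rw [add_pow, Nat.range_succ_eq_Iic]
  refine Finset.sum_le_sum fun i hi => ?_
  have h1 : 1 ≤ k.choose i := Nat.choose_pos (Finset.mem_Iic.1 hi)
  calc N.choose i ≤ N ^ i := Nat.choose_le_pow N i
    _ ≤ N ^ i * 1 ^ (k - i) * k.choose i := by simpa using Nat.le_mul_of_pos_right _ h1

/-- Sauer–Shelah, with VC dimension at most the dimension of the space of functionals. -/
theorem card_signPatterns_le {ι α V : Type*} [Fintype ι] [Fintype α] [DecidableEq α]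
    [Fintype V] (w : V → ι → ℝ) (a : α → ι → ℝ) :
    (Finset.univ.image fun v => Finset.univ.filter
      fun A => ∑ l, w v l * a A l < 0).card ≤ (Fintype.card α + 1) ^ Fintype.card ι := by
  refine (Finset.card_le_card_shatterer _).trans (Finset.card_shatterer_le_sum_vcDim.trans ?_)
  refine le_trans ?_ (sum_choose_le_pow _ _)
  refine Finset.sum_le_sum_of_subset (Finset.Iic_subset_Iic.2 ?_)
  exact Finset.sup_le fun s hs =>
    card_le_of_shatters_halfspaces w a (Finset.mem_shatterer.1 hs)

theorem sum_add_sum_compl_eq_one {ι : Type*} [Fintype ι] [DecidableEq ι] {w : ι → ℝ}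
    (hw : w ∈ stdSimplex ℝ ι) (A : Finset ι) : ∑ l ∈ A, w l + ∑ l ∈ Aᶜ, w l = 1 := by
  rw [Finset.sum_add_sum_compl, hw.2]

/-- Among more than `2 ^ (k ^ 2)` points, compared by a family of `k` orders, some point `x` is such
that in every weighted vote of the orders some other point precedes `x` by a weak majority. -/
theorem exists_forall_half_le {ι V : Type*} [Fintype ι] [DecidableEq ι] [Nonempty ι] [Fintype V]
    (B : V → V → Finset ι) (hB : ∀ x y, x ≠ y → B y x = (B x y)ᶜ)
    (hcard : 2 ^ (Fintype.card ι ^ 2) < Fintype.card V) :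
    ∃ x, ∀ w ∈ stdSimplex ℝ ι, ∃ y, y ≠ x ∧ 1 / 2 ≤ ∑ l ∈ B x y, w l := by
  by_contra! hcon
  choose w hw hlt using hcon
  let o : ι := Classical.arbitrary ι
  -- One set from each complementary pair suffices, as `B x y` or its complement contains `o`. This
  -- absorbs the `+ 1` of the pattern count, giving the bound 2^(k²).
  let α := {A : Finset ι // o ∈ A}
  -- With ±1 entries the functional equals twice the weight of `A` minus 1, so its sign compares
  -- that weight with 1/2.
  let a : α → ι → ℝ := fun A l => if l ∈ A.1 then 1 else -1
  have hcardα : Fintype.card α + 1 ≤ 2 ^ Fintype.card ι := by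
    have := Fintype.card_subtype_lt (p := fun A : Finset ι => o ∈ A) (x := ∅) (by simp)
    rwa [Fintype.card_finset] at this
  have himg := card_signPatterns_le w a
  have hlt' : (Finset.univ.image fun v => Finset.univ.filter
      fun A => ∑ l, w v l * a A l < 0).card < (Finset.univ : Finset V).card := by
    refine himg.trans_lt (lt_of_le_of_lt ?_ hcard)
    rw [pow_two, pow_mul]
    exact Nat.pow_le_pow_left hcardα _
  obtain ⟨x, -, y, -, hxy, hpat⟩ := Finset.exists_ne_map_eq_of_card_lt_of_maps_to hlt'
    (f := fun v => Finset.univ.filter fun A => ∑ l, w v l * a A l < 0)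
    (fun v _ => Finset.mem_image_of_mem _ (Finset.mem_univ v))
  have hval : ∀ v (A : α), ∑ l, w v l * a A l = 2 * ∑ l ∈ A.1, w v l - 1 := by
    intro v A
    have h1 := (hw v).2
    have h2 : ∀ l, w v l * a A l = 2 * (if l ∈ A.1 then w v l else 0) - w v l := by
      intro l
      by_cases h : l ∈ A.1 <;> simp [a, h]
      ring
    rw [Finset.sum_congr rfl fun l _ => h2 l, Finset.sum_sub_distrib, h1, ← Finset.mul_sum]
    simp
  have hiff : ∀ A : Finset ι, o ∈ A → (∑ l ∈ A, w x l < 1 / 2 ↔ ∑ l ∈ A, w y l < 1 / 2) := by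
    intro A hA
    have := Finset.ext_iff.1 hpat ⟨A, hA⟩
    simp only [Finset.mem_filter, Finset.mem_univ, true_and, hval] at this
    constructor <;> intro h <;> [have := this.1 (by linarith); have := this.2 (by linarith)] <;>
      linarith
  have h1 := hlt x y hxy.symm
  have h2 := hlt y x hxy
  rw [hB x y hxy] at h2
  by_cases ho : o ∈ B x y
  · have := sum_add_sum_compl_eq_one (hw y) (B x y)
    have := (hiff _ ho).1 h1
    linarith
  · have := sum_add_sum_compl_eq_one (hw x) (B x y)
    have := (hiff _ (Finset.mem_compl.2 ho)).2 h2
    linarith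

/-! ### Approximate majorities: rounding the weightings -/

/-- The number of integer points of a simplex, bounded by its generating function. -/
theorem card_sum_le_le_pow (ι : Type*) [Fintype ι] [DecidableEq ι] (T : ℕ) (hT : 1 ≤ T) :
    (Finset.univ.filter fun z : ι → Fin (Fintype.card ι * T + 1) =>
      ∑ l, (z l : ℕ) ≤ Fintype.card ι * T).card ≤ (3 * (T + 1)) ^ Fintype.card ι := by
  set k := Fintype.card ι
  set Z := Finset.univ.filter fun z : ι → Fin (k * T + 1) => ∑ l, (z l : ℕ) ≤ k * T
  have hT' : (0 : ℝ) < T := by exact_mod_cast hT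
  -- With this q, 1 / (1 - q) = T + 1 bounds each geometric sum, while q^(-T) = (1 + 1/T)^T ≤ e ≤ 3.
  set q : ℝ := T / (T + 1) with hq
  have hq0 : 0 < q := by positivity
  have hq1 : q < 1 := by rw [hq, div_lt_one (by positivity)]; linarith
  have h1 : (Z.card : ℝ) * q ^ (k * T) ≤ (T + 1 : ℝ) ^ k := by
    calc (Z.card : ℝ) * q ^ (k * T) = ∑ z ∈ Z, q ^ (k * T) := by simp
      _ ≤ ∑ z ∈ Z, ∏ l, q ^ (z l : ℕ) := by
        refine Finset.sum_le_sum fun z hz => ?_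
        rw [Finset.prod_pow_eq_pow_sum]
        exact pow_le_pow_of_le_one hq0.le hq1.le (Finset.mem_filter.1 hz).2
      _ ≤ ∑ z : ι → Fin (k * T + 1), ∏ l, q ^ (z l : ℕ) :=
        Finset.sum_le_sum_of_subset_of_nonneg (Finset.subset_univ _)
          fun z _ _ => Finset.prod_nonneg fun l _ => by positivity
      _ = ∏ _l : ι, ∑ j : Fin (k * T + 1), q ^ (j : ℕ) := by
        rw [Finset.prod_univ_sum, Fintype.piFinset_univ]
      _ ≤ ∏ _l : ι, (T + 1 : ℝ) := by
        refine Finset.prod_le_prod (fun l _ => Finset.sum_nonneg fun j _ => by positivity)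
          fun l _ => ?_
        rw [Fin.sum_univ_eq_sum_range (fun j => q ^ j), geom_sum_eq hq1.ne,
          ← neg_div_neg_eq, div_le_iff₀ (by linarith)]
        have : (T + 1 : ℝ) * -(q - 1) = 1 := by rw [hq]; field_simp; ring
        rw [this]
        linarith [pow_pos hq0 (k * T + 1)]
      _ = (T + 1 : ℝ) ^ k := by simp [k]
  have h2 : 1 ≤ (3 : ℝ) ^ k * q ^ (k * T) := by
    have h3 : 1 ≤ 3 * q ^ T := by
      have h4 : (1 + 1 / (T : ℝ)) ^ T ≤ 3 := by
        calc (1 + 1 / (T : ℝ)) ^ T ≤ (Real.exp (1 / T)) ^ T := by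
              gcongr
              rw [add_comm]
              exact Real.add_one_le_exp _
          _ = Real.exp 1 := by rw [← Real.exp_nat_mul]; congr 1; field_simp
          _ ≤ 3 := by linarith [Real.exp_one_lt_d9]
      have h5 : (1 + 1 / (T : ℝ)) ^ T * q ^ T = 1 := by
        rw [← mul_pow, hq]
        have : (1 + 1 / (T : ℝ)) * (T / (T + 1)) = 1 := by field_simp
        rw [this, one_pow]
      rw [← h5]
      gcongr
    rw [mul_comm k T, pow_mul, ← mul_pow]
    exact one_le_pow₀ h3
  have h6 : (Z.card : ℝ) ≤ (3 * (T + 1)) ^ k := by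
    calc (Z.card : ℝ) ≤ Z.card * ((3 : ℝ) ^ k * q ^ (k * T)) :=
          le_mul_of_one_le_right (by positivity) h2
      _ = 3 ^ k * (Z.card * q ^ (k * T)) := by ring
      _ ≤ 3 ^ k * (T + 1) ^ k := by gcongr
      _ = _ := by rw [mul_pow]
  exact_mod_cast h6

/-- Among more than `(3 * (T + 1)) ^ k` points, compared by a family of `k` orders, some point `x`
is such that in every weighted vote of the orders the fraction in favor of some other point
preceding `x` is at least `1 / 2 - 1 / (2 * T)`. -/
theorem exists_forall_half_sub_le {ι V : Type*} [Fintype ι] [DecidableEq ι] [Nonempty ι]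
    [Fintype V] (B : V → V → Finset ι) (hB : ∀ x y, x ≠ y → B y x = (B x y)ᶜ)
    (T : ℕ) (hT : 1 ≤ T) (hcard : (3 * (T + 1)) ^ Fintype.card ι < Fintype.card V) :
    ∃ x, ∀ w ∈ stdSimplex ℝ ι, ∃ y, y ≠ x ∧ 1 / 2 - 1 / (2 * T : ℝ) ≤ ∑ l ∈ B x y, w l := by
  by_contra! hcon
  choose w hw hlt using hcon
  set k := Fintype.card ι with hk
  have hk0 : 0 < k := Fintype.card_pos
  have hT' : (0 : ℝ) < T := by exact_mod_cast hT
  have hk' : (0 : ℝ) < k := by exact_mod_cast hk0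
  have hw1 : ∀ v l, w v l ≤ 1 := fun v l => by
    rw [← (hw v).2]
    exact Finset.single_le_sum (fun i _ => (hw v).1 i) (Finset.mem_univ l)
  have hfl : ∀ v l, (⌊w v l * (k * T : ℕ)⌋₊ : ℝ) ≤ w v l * (k * T : ℕ) := fun v l =>
    Nat.floor_le (mul_nonneg ((hw v).1 l) (by positivity))
  -- Rounding down to multiples of 1/(kT): equal roundings change the weight of a set of orders by
  -- at most k · 1/(kT) = 1/T.
  let z : V → ι → Fin (k * T + 1) := fun v l => ⟨⌊w v l * (k * T : ℕ)⌋₊, by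
    rw [Nat.lt_succ_iff]
    have : (⌊w v l * (k * T : ℕ)⌋₊ : ℝ) ≤ (k * T : ℕ) :=
      (hfl v l).trans (mul_le_of_le_one_left (by positivity) (hw1 v l))
    exact_mod_cast this⟩
  have hz : ∀ v, ∑ l, (z v l : ℕ) ≤ k * T := by
    intro v
    have : ((∑ l, (z v l : ℕ) : ℕ) : ℝ) ≤ (k * T : ℕ) := by
      push_cast
      calc ∑ l, ((z v l : ℕ) : ℝ) ≤ ∑ l, w v l * (k * T : ℕ) :=
            Finset.sum_le_sum fun l _ => hfl v l
        _ = k * T := by rw [← Finset.sum_mul, (hw v).2, one_mul]; push_cast; rfl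
    exact_mod_cast this
  obtain ⟨x, -, y, -, hxy, hzz⟩ := Finset.exists_ne_map_eq_of_card_lt_of_maps_to
    (s := (Finset.univ : Finset V))
    ((card_sum_le_le_pow ι T hT).trans_lt hcard) (f := z)
    (fun v _ => by simpa [← hk] using hz v)
  have hdiff : ∀ l, w y l - w x l ≤ 1 / (k * T) := by
    intro l
    have h1 : ⌊w x l * (k * T : ℕ)⌋₊ = ⌊w y l * (k * T : ℕ)⌋₊ :=
      congrArg (fun g : ι → Fin (k * T + 1) => (g l : ℕ)) hzz
    have h2 := hfl x l
    have h3 := Nat.lt_floor_add_one (w y l * (k * T : ℕ))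
    rw [h1] at h2
    push_cast at h2 h3
    rw [le_div_iff₀ (by positivity)]
    linarith
  have h1 := hlt x y hxy.symm
  have h2 := hlt y x hxy
  rw [hB x y hxy] at h2
  have h3 := sum_add_sum_compl_eq_one (hw y) (B x y)
  have h4 : ∑ l ∈ B x y, w y l - ∑ l ∈ B x y, w x l ≤ 1 / T := by
    rw [← Finset.sum_sub_distrib]
    calc ∑ l ∈ B x y, (w y l - w x l) ≤ ∑ l ∈ B x y, 1 / (k * T : ℝ) :=
          Finset.sum_le_sum fun l _ => hdiff l
      _ = (B x y).card * (1 / (k * T : ℝ)) := by simp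
      _ ≤ k * (1 / (k * T : ℝ)) := by
        gcongr
        exact Finset.card_le_univ _
      _ = 1 / T := by field_simp
  have h5 : 1 / (2 * T : ℝ) = 1 / T / 2 := by field_simp
  rw [h5] at h1 h2
  linarith

/-! ### The hard instance: gambler and prophet -/

/-- The hard instance, as a function of a uniform variable: the index `x` carries the value `H` with
probability `p` and `0` otherwise; an index `y ≠ x` of weight `μ y > 0` carries a value in
`[1, 1 + δ]` that is at most `1 + δ * u` with probability `u ^ μ y`. -/
noncomputable def hardValue {n : ℕ} (x : Fin n) (p : I) (H δ : ℝ≥0) (μ : Fin n → ℝ) (y : Fin n)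
    (U : I) : ℝ≥0 :=
  if y = x then (if U ≤ p then H else 0)
  else if μ y = 0 then 0 else 1 + δ * (unitInterval.toNNReal U) ^ (μ y)⁻¹

/-- The laws of the values of the hard instance. -/
noncomputable def hardLaw {n : ℕ} (x : Fin n) (p : I) (H δ : ℝ≥0) (μ : Fin n → ℝ) (y : Fin n) :
    Measure ℝ≥0 :=
  (volume : Measure I).map (hardValue x p H δ μ y)

section HardInstance

variable {n : ℕ} {x : Fin n} {p : I} {H δ : ℝ≥0} {μ : Fin n → ℝ}

theorem measurable_hardValue (y : Fin n) : Measurable (hardValue x p H δ μ y) := by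
  unfold hardValue
  split_ifs with h1 h2
  · exact Measurable.ite measurableSet_Iic measurable_const measurable_const
  · exact measurable_const
  · exact ((unitInterval.toNNReal_continuous.measurable.pow_const _).const_mul _).const_add _

instance (y : Fin n) : IsProbabilityMeasure (hardLaw x p H δ μ y) :=
  Measure.isProbabilityMeasure_map (measurable_hardValue y).aemeasurable

instance : IsProbabilityMeasure (sampleLaw (hardLaw x p H δ μ)) := by
  unfold sampleLaw
  infer_instance

theorem ae_of_forall_hardValue {P : ℝ≥0 → Prop} (hP : MeasurableSet {t | P t}) (y : Fin n)
    (h : ∀ᵐ U : I, P (hardValue x p H δ μ y U)) :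
    ∀ᵐ ω ∂(sampleLaw (hardLaw x p H δ μ)), P (ω y).1 := by
  have h1 : ∀ᵐ t ∂(hardLaw x p H δ μ y), P t :=
    (ae_map_iff (measurable_hardValue y).aemeasurable hP).2 h
  have h2 : ∀ᵐ q ∂((hardLaw x p H δ μ y).prod (volume : Measure I)), P q.1 :=
    Measure.quasiMeasurePreserving_fst.ae h1
  exact (Measure.quasiMeasurePreserving_eval (μ := fun i => (hardLaw x p H δ μ i).prod
    (volume : Measure I)) y).ae h2

theorem sampleLaw_hardLaw_forall_mem (s : Fin n → Set ℝ≥0) (hs : ∀ y, MeasurableSet (s y)) :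
    sampleLaw (hardLaw x p H δ μ) {ω | ∀ y, (ω y).1 ∈ s y} =
      ∏ y, (volume : Measure I) (hardValue x p H δ μ y ⁻¹' s y) := by
  have h1 : {ω : Sample n | ∀ y, (ω y).1 ∈ s y} =
      Set.univ.pi fun y => (s y) ×ˢ (Set.univ : Set I) := by
    ext ω
    simp [Set.mem_pi]
  rw [h1, sampleLaw, Measure.pi_pi]
  refine Finset.prod_congr rfl fun y _ => ?_
  rw [Measure.prod_prod, measure_univ, mul_one, hardLaw,
    Measure.map_apply (measurable_hardValue y) (hs y)]

theorem measurableSet_forall_mem (s : Fin n → Set ℝ≥0) (hs : ∀ y, MeasurableSet (s y)) :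
    MeasurableSet {ω : Sample n | ∀ y, (ω y).1 ∈ s y} := by
  rw [Set.ofPred_forall]
  exact MeasurableSet.iInter fun y => (measurable_pi_apply y).fst (hs y)

theorem hardValue_self (U : I) :
    hardValue x p H δ μ x U = 0 ∨ hardValue x p H δ μ x U = H := by
  unfold hardValue
  split_ifs <;> simp_all

theorem hardValue_of_ne {y : Fin n} (hy : y ≠ x) (hμ : ∀ i, 0 ≤ μ i) (U : I) :
    hardValue x p H δ μ y U = 0 ∨
      1 ≤ hardValue x p H δ μ y U ∧ hardValue x p H δ μ y U ≤ 1 + δ := by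
  unfold hardValue
  rw [if_neg hy]
  split_ifs with h
  · exact Or.inl rfl
  · right
    refine ⟨le_self_add, ?_⟩
    gcongr
    refine mul_le_of_le_one_right zero_le (NNReal.rpow_le_one ?_ (inv_nonneg.2 (hμ y)))
    exact U.2.2

theorem one_le_hardValue {y : Fin n} (hy : y ≠ x) (h : μ y ≠ 0) (U : I) :
    1 ≤ hardValue x p H δ μ y U := by
  unfold hardValue
  rw [if_neg hy, if_neg h]
  exact le_self_add

theorem volume_hardValue_self_ne_zero (hH : H ≠ 0) :
    (volume : Measure I) (hardValue x p H δ μ x ⁻¹' {0}ᶜ) = unitInterval.toNNReal p := by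
  have : hardValue x p H δ μ x ⁻¹' {0}ᶜ = Set.Iic p := by
    ext U
    simp [hardValue, hH]
  rw [this, unitInterval.volume_Iic, ENNReal.ofReal, ← unitInterval.coe_toNNReal,
    Real.toNNReal_coe]

theorem volume_hardValue_le {y : Fin n} (hy : y ≠ x) (hμ : ∀ i, 0 ≤ μ i) (hδ : δ ≠ 0) {u : ℝ≥0}
    (hu : u ≤ 1) :
    (volume : Measure I) (hardValue x p H δ μ y ⁻¹' Set.Iic (1 + δ * u)) = (u ^ μ y : ℝ≥0) := by
  by_cases h : μ y = 0
  · have : hardValue x p H δ μ y ⁻¹' Set.Iic (1 + δ * u) = Set.univ := by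
      ext U
      simp [hardValue, hy, h]
    simp [this, h]
  · have hpos : 0 < μ y := lt_of_le_of_ne (hμ y) (Ne.symm h)
    have hu1 : u ^ μ y ≤ 1 := NNReal.rpow_le_one hu (hμ y)
    have : hardValue x p H δ μ y ⁻¹' Set.Iic (1 + δ * u) =
        Set.Iic (⟨(u ^ μ y : ℝ≥0), NNReal.coe_nonneg _, by exact_mod_cast hu1⟩ : I) := by
      ext U
      simp only [hardValue, hy, h, if_false, Set.mem_preimage, Set.mem_Iic]
      rw [add_le_add_iff_left, mul_le_mul_iff_right₀ (pos_iff_ne_zero.2 hδ),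
        NNReal.rpow_inv_le_iff hpos]
      rfl
    rw [this, unitInterval.volume_Iic, ENNReal.ofReal, Real.toNNReal_coe]

/-- Away from x the only possible atom is 0, so the rule's freedom at ties is harmless. -/
theorem ae_hardValue_ne {y : Fin n} (hy : y ≠ x) (hδ : δ ≠ 0) (u : ℝ≥0) :
    ∀ᵐ U : I, hardValue x p H δ μ y U ≠ 1 + δ * u := by
  by_cases h : μ y = 0
  · refine Filter.Eventually.of_forall fun U => ?_
    simp only [hardValue, hy, h, if_false, if_true]
    exact (add_pos_of_pos_of_nonneg one_pos zero_le).ne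
  · rw [ae_iff]
    refine Set.Subsingleton.measure_zero ?_ _
    intro U hU U' hU'
    simp only [hardValue, hy, h, if_false, Set.mem_ofPred_eq, not_not] at hU hU'
    have h1 := mul_left_cancel₀ hδ (add_left_cancel (hU.trans hU'.symm))
    have h2 := NNReal.rpow_left_injective (inv_ne_zero h) h1
    exact Subtype.ext (congrArg NNReal.toReal h2)

theorem prod_rpow_eq_rpow_sum (u : ℝ≥0) (s : Finset (Fin n)) (hμ : ∀ i, 0 ≤ μ i) :
    ∏ y ∈ s, u ^ μ y = u ^ ∑ y ∈ s, μ y := by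
  apply NNReal.coe_injective
  push_cast
  exact (Real.rpow_sum_of_nonneg u.2 fun i _ => hμ i).symm

/-- The product of the u^(μ y) is u because the weights sum to 1, however they are split. -/
theorem sampleLaw_hardLaw_forall_le (hμ : μ ∈ stdSimplex ℝ (Fin n)) (hx : μ x = 0) (hδ : δ ≠ 0)
    {u : ℝ≥0} (hu : u ≤ 1) :
    sampleLaw (hardLaw x p H δ μ)
      {ω | ∀ y, (ω y).1 ∈ if y = x then Set.univ else Set.Iic (1 + δ * u)} = u := by
  rw [sampleLaw_hardLaw_forall_mem _ fun y => by split_ifs <;> measurability]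
  have : ∀ y, (volume : Measure I) (hardValue x p H δ μ y ⁻¹'
      if y = x then Set.univ else Set.Iic (1 + δ * u)) = (u ^ μ y : ℝ≥0) := by
    intro y
    split_ifs with h
    · simp [h, hx]
    · exact volume_hardValue_le h hμ.1 hδ hu
  rw [Finset.prod_congr rfl fun y _ => this y, ← ENNReal.ofNNReal_finsetProd,
    prod_rpow_eq_rpow_sum u _ hμ.1, hμ.2, NNReal.rpow_one]

theorem sampleLaw_hardLaw_ne_zero_and_forall_le (hμ : μ ∈ stdSimplex ℝ (Fin n)) (hδ : δ ≠ 0)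
    (hH : H ≠ 0) {u : ℝ≥0} (hu : u ≤ 1) (s : Finset (Fin n)) (hs : x ∉ s) :
    sampleLaw (hardLaw x p H δ μ)
      {ω | ∀ y, (ω y).1 ∈ if y = x then {0}ᶜ else if y ∈ s then Set.Iic (1 + δ * u)
        else Set.univ} = (unitInterval.toNNReal p * u ^ ∑ y ∈ s, μ y : ℝ≥0) := by
  rw [sampleLaw_hardLaw_forall_mem _ fun y => by split_ifs <;> measurability]
  have : ∀ y, (volume : Measure I) (hardValue x p H δ μ y ⁻¹'
      if y = x then {0}ᶜ else if y ∈ s then Set.Iic (1 + δ * u) else Set.univ) =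
      ((if y = x then unitInterval.toNNReal p else 1) * (if y ∈ s then u ^ μ y else 1) : ℝ≥0) := by
    intro y
    split_ifs with h h' h'
    · exact absurd (h ▸ h') hs
    · rw [h, volume_hardValue_self_ne_zero hH, mul_one]
    · rw [volume_hardValue_le h hμ.1 hδ hu, one_mul]
    · simp
  rw [Finset.prod_congr rfl fun y _ => this y, ← ENNReal.ofNNReal_finsetProd,
    Finset.prod_mul_distrib, Finset.prod_ite_eq', if_pos (Finset.mem_univ x),
    Finset.prod_ite_mem, Finset.univ_inter, prod_rpow_eq_rpow_sum u _ hμ.1]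

/-- Only the threshold clipped to [1, 1 + δ] matters; one above 1 + δ behaves like u = 1. -/
theorem exists_threshold_level (hδ : δ ≠ 0) (θ : ℝ) :
    ∃ u : ℝ≥0, u ≤ 1 ∧
      (((1 + δ * u : ℝ≥0) : ℝ) = max θ 1 ∨ (((1 + δ : ℝ≥0) : ℝ) < θ ∧ u = 1)) := by
  have hδ' : (0 : ℝ) < δ := by exact_mod_cast pos_iff_ne_zero.2 hδ
  rcases lt_or_ge ((1 + δ : ℝ≥0) : ℝ) θ with h | h
  · exact ⟨1, le_rfl, Or.inr ⟨h, rfl⟩⟩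
  · push_cast at h
    refine ⟨Real.toNNReal ((max θ 1 - 1) / δ), ?_, Or.inl ?_⟩
    · rw [Real.toNNReal_le_one, div_le_one hδ']
      have : max θ 1 ≤ 1 + δ := max_le h (by linarith)
      linarith
    · push_cast
      rw [Real.coe_toNNReal _ (div_nonneg (by linarith [le_max_right θ 1]) hδ'.le),
        mul_div_cancel₀ _ hδ'.ne']
      ring

/-- On the hard instance, a threshold rule gains at most `1 + δ` when some value at an index other
than `x` exceeds the threshold, and the value at `x` when no value before it does. -/
theorem gamblerValue_hardLaw_le (hμ : μ ∈ stdSimplex ℝ (Fin n)) (hx : μ x = 0) (hδ : δ ≠ 0)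
    (hH : H ≠ 0) {π : Equiv.Perm (Fin n)} {θ : ℝ} {τ : Sample n → WithTop (Fin n)}
    (hτ : IsThresholdRule π θ τ) :
    ∃ u : ℝ≥0, u ≤ 1 ∧ gamblerValue (hardLaw x p H δ μ) π τ ≤
      ((1 + δ) * (1 - u) + H * (unitInterval.toNNReal p *
        u ^ ∑ y with π.symm y < π.symm x, μ y) : ℝ≥0) := by
  obtain ⟨u, hu, hθ⟩ := exists_threshold_level hδ θ
  refine ⟨u, hu, ?_⟩
  set s : Finset (Fin n) := Finset.univ.filter fun y => π.symm y < π.symm x with hs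
  set A : Set (Sample n) :=
    {ω | ∀ y, (ω y).1 ∈ if y = x then Set.univ else Set.Iic (1 + δ * u)} with hA
  set B : Set (Sample n) := {ω | ∀ y, (ω y).1 ∈ if y = x then {0}ᶜ else if y ∈ s then
    Set.Iic (1 + δ * u) else Set.univ} with hB
  have hAm : MeasurableSet A :=
    measurableSet_forall_mem _ fun y => by split_ifs <;> measurability
  have hBm : MeasurableSet B :=
    measurableSet_forall_mem _ fun y => by split_ifs <;> measurability
  have hself : ∀ᵐ ω ∂(sampleLaw (hardLaw x p H δ μ)), (ω x).1 = 0 ∨ (ω x).1 = H :=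
    ae_of_forall_hardValue (P := fun t => t = 0 ∨ t = H)
      ((measurableSet_singleton 0).union (measurableSet_singleton H)) x
      (Filter.Eventually.of_forall hardValue_self)
  have hother : ∀ᵐ ω ∂(sampleLaw (hardLaw x p H δ μ)), ∀ y, y ≠ x →
      (ω y).1 = 0 ∨ 1 ≤ (ω y).1 ∧ (ω y).1 ≤ 1 + δ := by
    rw [ae_all_iff]
    intro y
    by_cases hy : y = x
    · exact Filter.Eventually.of_forall fun ω h => absurd hy h
    · filter_upwards [ae_of_forall_hardValue (P := fun t => t = 0 ∨ 1 ≤ t ∧ t ≤ 1 + δ)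
        ((measurableSet_singleton 0).union measurableSet_Icc) y
        (Filter.Eventually.of_forall (hardValue_of_ne hy hμ.1))] with ω h _ using h
  have hne : ∀ᵐ ω ∂(sampleLaw (hardLaw x p H δ μ)), ∀ y, y ≠ x → (ω y).1 ≠ 1 + δ * u := by
    rw [ae_all_iff]
    intro y
    by_cases hy : y = x
    · exact Filter.Eventually.of_forall fun ω h => absurd hy h
    · filter_upwards [ae_of_forall_hardValue (P := fun t => t ≠ 1 + δ * u)
        (measurableSet_singleton _).compl y (ae_hardValue_ne hy hδ u)] with ω h _ using h
  have hbound : ∀ᵐ ω ∂(sampleLaw (hardLaw x p H δ μ)),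
      (selectedValue π ω (τ ω) : ℝ≥0∞) ≤
        Aᶜ.indicator (fun _ => ((1 + δ : ℝ≥0) : ℝ≥0∞)) ω + B.indicator (fun _ => (H : ℝ≥0∞)) ω := by
    filter_upwards [hself, hother, hne] with ω h1 h2 h3
    rcases hk : τ ω with _ | k
    · simp [selectedValue]
    change (((ω (π k)).1 : ℝ≥0) : ℝ≥0∞) ≤ _
    have hk' : τ ω = (k : WithTop (Fin n)) := hk
    by_cases hz : (ω (π k)).1 = 0
    · simp [hz]
    have hge : θ ≤ ((ω (π k)).1 : ℝ) := by
      by_contra! hlt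
      exact hτ.ne_of_lt ω k hlt hk'
    -- Reaching x means that nothing before x exceeded the threshold, which is the event `B`. A
    -- nonzero selection elsewhere is strictly above the level almost surely, hence outside `A`, and
    -- is worth at most 1 + δ.
    by_cases hkx : π k = x
    · have hmem : ω ∈ B := by
        intro y
        split_ifs with hy hys
        · rw [hy, ← hkx]
          exact hz
        · rw [Set.mem_Iic]
          by_contra! hlt
          have hyθ : θ < ((ω (π (π.symm y))).1 : ℝ) := by
            rw [Equiv.apply_symm_apply]
            rcases hθ with hθ | ⟨-, hu1⟩
            · exact ((le_max_left θ 1).trans_eq hθ.symm).trans_lt (by exact_mod_cast hlt)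
            · rcases h2 y hy with h0 | ⟨-, h0⟩
              · rw [h0] at hlt
                exact absurd hlt (not_lt.2 zero_le)
              · rw [hu1, mul_one] at hlt
                exact absurd h0 (not_le.2 hlt)
          have hle := hτ.le_of_gt ω _ hyθ
          rw [hk', WithTop.coe_le_coe] at hle
          rw [hs, Finset.mem_filter, ← hkx, Equiv.symm_apply_apply] at hys
          exact absurd hle (not_le.2 hys.2)
        · exact Set.mem_univ _
      rw [Set.indicator_of_mem hmem, hkx]
      refine le_add_left ?_
      rcases h1 with h1 | h1
      · simp [h1]
      · rw [h1]
    · have hmem : ω ∈ Aᶜ := by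
        intro hωA
        have hle := hωA (π k)
        rw [if_neg hkx, Set.mem_Iic] at hle
        have hlt := lt_of_le_of_ne hle (h3 _ hkx)
        obtain ⟨hlo, hhi⟩ := (h2 _ hkx).resolve_left hz
        rcases hθ with hθ | ⟨hθ, -⟩
        · have h4 : max θ 1 ≤ ((ω (π k)).1 : ℝ) := max_le hge (by exact_mod_cast hlo)
          rw [← hθ] at h4
          exact absurd hlt (not_lt.2 (by exact_mod_cast h4))
        · have h4 : ((ω (π k)).1 : ℝ) ≤ ((1 + δ : ℝ≥0) : ℝ) := by exact_mod_cast hhi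
          linarith
      rw [Set.indicator_of_mem hmem]
      refine le_add_right ?_
      exact_mod_cast ((h2 _ hkx).resolve_left hz).2
  calc gamblerValue (hardLaw x p H δ μ) π τ
      ≤ ∫⁻ ω, (Aᶜ.indicator (fun _ => ((1 + δ : ℝ≥0) : ℝ≥0∞)) ω +
          B.indicator (fun _ => (H : ℝ≥0∞)) ω) ∂(sampleLaw (hardLaw x p H δ μ)) :=
        lintegral_mono_ae hbound
    _ = (1 + δ : ℝ≥0) * (1 - u) + H * (unitInterval.toNNReal p * u ^ ∑ y ∈ s, μ y : ℝ≥0) := by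
        rw [lintegral_add_left (measurable_const.indicator hAm.compl),
          lintegral_indicator_const hAm.compl, lintegral_indicator_const hBm,
          prob_compl_eq_one_sub hAm, hA, sampleLaw_hardLaw_forall_le hμ hx hδ hu, hB,
          sampleLaw_hardLaw_ne_zero_and_forall_le hμ hδ hH hu s (by simp [hs])]
    _ = _ := by push_cast; rfl

/-- On the hard instance, the maximum has expectation at least `1 + H * p - p`. -/
theorem le_prophetValue_hardLaw_add (hμ : μ ∈ stdSimplex ℝ (Fin n)) (hx : μ x = 0)
    (hH : H ≠ 0) :
    ((1 + H * unitInterval.toNNReal p : ℝ≥0) : ℝ≥0∞) ≤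
      prophetValue (hardLaw x p H δ μ) + (unitInterval.toNNReal p : ℝ≥0∞) := by
  obtain ⟨y₀, hy₀⟩ : ∃ y, μ y ≠ 0 := by
    by_contra! h
    have := hμ.2
    simp [h] at this
  have hyx : y₀ ≠ x := fun h => hy₀ (h ▸ hx)
  set P : Set (Sample n) := {ω | (ω x).1 ∈ ({0}ᶜ : Set ℝ≥0)} with hP
  have hPm : MeasurableSet P := (measurable_pi_apply x).fst (measurableSet_singleton 0).compl
  have hPp : sampleLaw (hardLaw x p H δ μ) P = unitInterval.toNNReal p := by
    have h1 : P = {ω | ∀ y, (ω y).1 ∈ if y = x then ({0}ᶜ : Set ℝ≥0) else Set.univ} := by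
      ext ω
      simp only [hP, Set.mem_ofPred_eq]
      refine ⟨fun h y => ?_, fun h => by simpa using h x⟩
      split_ifs with hy
      · rwa [hy]
      · exact Set.mem_univ _
    rw [h1, sampleLaw_hardLaw_forall_mem _ fun y => by split_ifs <;> measurability,
      Finset.prod_eq_single x]
    · rw [if_pos rfl, volume_hardValue_self_ne_zero hH]
    · intro y _ hy
      simp [hy]
    · simp
  have hself : ∀ᵐ ω ∂(sampleLaw (hardLaw x p H δ μ)), (ω x).1 = 0 ∨ (ω x).1 = H :=
    ae_of_forall_hardValue (P := fun t => t = 0 ∨ t = H)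
      ((measurableSet_singleton 0).union (measurableSet_singleton H)) x
      (Filter.Eventually.of_forall hardValue_self)
  have hone : ∀ᵐ ω ∂(sampleLaw (hardLaw x p H δ μ)), 1 ≤ (ω y₀).1 :=
    ae_of_forall_hardValue (P := fun t => 1 ≤ t) measurableSet_Ici y₀
      (Filter.Eventually.of_forall (one_le_hardValue hyx hy₀))
  -- On `P` the maximum is at least H, and the extra 1 on the right pays for the 1 on the left; the
  -- additive form avoids truncated subtraction.
  have hbound : ∀ᵐ ω ∂(sampleLaw (hardLaw x p H δ μ)),
      1 + P.indicator (fun _ => (H : ℝ≥0∞)) ω ≤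
        (⨆ i, ((ω i).1 : ℝ≥0∞)) + P.indicator (fun _ => 1) ω := by
    filter_upwards [hself, hone] with ω h1 h2
    by_cases hω : ω ∈ P
    · rw [Set.indicator_of_mem hω, Set.indicator_of_mem hω, add_comm]
      gcongr
      rw [← h1.resolve_left hω]
      exact le_iSup (fun i => ((ω i).1 : ℝ≥0∞)) x
    · rw [Set.indicator_of_notMem hω, Set.indicator_of_notMem hω, add_zero, add_zero]
      exact le_iSup_of_le y₀ (by exact_mod_cast h2)
  calc ((1 + H * unitInterval.toNNReal p : ℝ≥0) : ℝ≥0∞)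
      = ∫⁻ ω, (1 + P.indicator (fun _ => (H : ℝ≥0∞)) ω) ∂(sampleLaw (hardLaw x p H δ μ)) := by
        rw [lintegral_add_left measurable_const, lintegral_indicator_const hPm, hPp]
        simp
    _ ≤ ∫⁻ ω, ((⨆ i, ((ω i).1 : ℝ≥0∞)) + P.indicator (fun _ => 1) ω)
          ∂(sampleLaw (hardLaw x p H δ μ)) := lintegral_mono_ae hbound
    _ = _ := by
        rw [lintegral_add_right _ (measurable_const.indicator hPm),
          lintegral_indicator_const hPm, hPp, one_mul, prophetValue]

end HardInstance

/-! ### From weights preceding x to the golden ratio -/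

open Real in
-- Weighted AM-GM on (√u)^(1-2η) · 1^(2η) gives u^b ≤ √u + 2η; completing the square in √u does the
-- rest. The case 0^0 = 1 needs b = 0, which forces η = 1/2.
theorem one_sub_add_mul_rpow_le {u b η : ℝ} (hu0 : 0 ≤ u) (hu1 : u ≤ 1) (hη : 0 ≤ η)
    (hη1 : η ≤ 1 / 2) (hb : 1 / 2 - η ≤ b) {v : ℝ} (hv : 0 ≤ v) :
    1 - u + v * u ^ b ≤ 1 + v ^ 2 / 4 + 2 * η * v := by
  have h1 : u ^ b ≤ √u + 2 * η := by
    rcases hu0.eq_or_lt with rfl | hpos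
    · rcases eq_or_ne b 0 with rfl | hb0
      · simp only [rpow_zero, sqrt_zero]
        linarith
      · rw [zero_rpow hb0, sqrt_zero]
        linarith
    · calc u ^ b ≤ u ^ (1 / 2 - η) := rpow_le_rpow_of_exponent_ge hpos hu1 hb
        _ = (√u) ^ (1 - 2 * η) * 1 ^ (2 * η) := by
          rw [one_rpow, mul_one, sqrt_eq_rpow, ← rpow_mul hu0]
          congr 1
          ring
        _ ≤ (1 - 2 * η) * √u + 2 * η * 1 :=
          geom_mean_le_arith_mean2_weighted (by linarith) (by linarith) (sqrt_nonneg u)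
            zero_le_one (by ring)
        _ ≤ √u + 2 * η := by nlinarith [sqrt_nonneg u]
  have h2 := mul_le_mul_of_nonneg_left h1 hv
  nlinarith [sq_nonneg (√u - v / 2), sq_sqrt hu0]

/-- If some index `x` is preceded, in every order of `S`, by other indices of total weight at least
`1 / 2 - η`, then the threshold prophet ratio of `S` is at most `φ⁻¹ + 2 * η`. -/
theorem TPR_le_of_weights {n : ℕ} {S : Finset (Equiv.Perm (Fin n))} {x : Fin n} {μ : Fin n → ℝ}
    (hμ : μ ∈ stdSimplex ℝ (Fin n)) (hx : μ x = 0) {η : ℝ} (hη : 0 ≤ η) (hη1 : η ≤ 1 / 2)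
    (hS : ∀ π ∈ S, 1 / 2 - η ≤ ∑ y with π.symm y < π.symm x, μ y) :
    TPR S ≤ ENNReal.ofReal (Real.goldenRatio⁻¹ + 2 * η) := by
  set g : ℝ := Real.goldenRatio⁻¹ with hg
  have hg0 : 0 < g := inv_pos.2 Real.goldenRatio_pos
  have hg1 : g < 1 := inv_lt_one_of_one_lt₀ Real.one_lt_goldenRatio
  have hg2 : g ^ 2 = 1 - g := by
    have h1 := Real.goldenRatio_sq
    have h2 : g * Real.goldenRatio = 1 := inv_mul_cancel₀ Real.goldenRatio_ne_zero
    linear_combination -g ^ 2 * h1 + (g * Real.goldenRatio + 1 - g) * h2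
  refine iSup₂_le fun α hα => ?_
  rw [← ENNReal.ofReal_coe_nnreal]
  refine ENNReal.ofReal_le_ofReal ?_
  have key : ∀ δ : ℝ, 0 < δ → δ ≤ 1 / 2 →
      (α : ℝ) * (1 + 2 * g) ≤ δ * (1 + 2 * g * α) + (1 + g ^ 2 + 4 * η * g) := by
    intro δ hδ hδ1
    let d : ℝ≥0 := ⟨δ, hδ.le⟩
    have hd : d ≠ 0 := fun h => hδ.ne' (congrArg NNReal.toReal h)
    -- With H = 1/δ the rare value contributes v = 2g, the minimizer of (1 + v²/4) / (1 + v) over v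
    -- ≥ 0.
    let p : I := ⟨2 * g * δ, by positivity, by nlinarith⟩
    obtain ⟨π, hπ, θ, τ, hτ, hle⟩ := hα (hardLaw x p d⁻¹ d μ) fun i => inferInstance
    obtain ⟨u, hu, hgam⟩ := gamblerValue_hardLaw_le (p := p) hμ hx hd (inv_ne_zero hd) hτ
    have hpro := le_prophetValue_hardLaw_add (p := p) (δ := d) hμ hx (inv_ne_zero hd)
    have h1 : ((α * (1 + d⁻¹ * unitInterval.toNNReal p) : ℝ≥0) : ℝ≥0∞) ≤
        (((1 + d) * (1 - u) + d⁻¹ * (unitInterval.toNNReal p *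
          u ^ ∑ y with π.symm y < π.symm x, μ y) + α * unitInterval.toNNReal p : ℝ≥0) : ℝ≥0∞) := by
      rw [ENNReal.coe_mul, ENNReal.coe_add _ (α * _), ENNReal.coe_mul α]
      calc (α : ℝ≥0∞) * _ ≤ α * (prophetValue (hardLaw x p d⁻¹ d μ) +
            (unitInterval.toNNReal p : ℝ≥0∞)) := by gcongr
        _ ≤ _ := by
          rw [mul_add]
          gcongr
          exact hle.trans hgam
    rw [ENNReal.coe_le_coe, ← NNReal.coe_le_coe] at h1
    push_cast [NNReal.coe_sub hu] at h1
    have hdδ : (d : ℝ) = δ := rfl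
    have hpδ : ((p : I) : ℝ) = 2 * g * δ := rfl
    rw [unitInterval.coe_toNNReal, hdδ, hpδ] at h1
    set b := ∑ y with π.symm y < π.symm x, μ y
    have h2 := one_sub_add_mul_rpow_le (u := u) u.2 (by exact_mod_cast hu) hη hη1 (hS π hπ)
      (v := 2 * g) (by positivity)
    have h3 : δ⁻¹ * (2 * g * δ) = 2 * g := by field_simp
    have h4 : δ⁻¹ * (2 * g * δ * (u : ℝ) ^ b) = 2 * g * (u : ℝ) ^ b := by field_simp
    rw [h3, h4] at h1
    have h5 : 0 ≤ δ * u := mul_nonneg hδ.le u.2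
    nlinarith
  -- This is `key` in the limit δ → 0: an excess r is refuted by a δ whose error term is at most
  -- r/2.
  have hlim : (α : ℝ) * (1 + 2 * g) ≤ 1 + g ^ 2 + 4 * η * g := by
    by_contra! hlt
    have hα0 : (0 : ℝ) ≤ α := α.2
    have hc : 0 < 1 + 2 * g * α := by positivity
    set r := (α : ℝ) * (1 + 2 * g) - (1 + g ^ 2 + 4 * η * g) with hr
    have hr0 : 0 < r := by linarith
    have hδ0 : 0 < min (1 / 2) (r / (2 * (1 + 2 * g * α))) := by positivity
    have h1 := key _ hδ0 (min_le_left _ _)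
    have h2 : min (1 / 2) (r / (2 * (1 + 2 * g * α))) * (1 + 2 * g * α) ≤ r / 2 := by
      calc _ ≤ r / (2 * (1 + 2 * g * α)) * (1 + 2 * g * α) := by
            gcongr
            exact min_le_right _ _
        _ = r / 2 := by field_simp
    linarith
  -- From g² = 1 - g follows g(1 + 2g) = 1 + g².
  have h6 : (1 + 2 * g) * α ≤ (1 + 2 * g) * (g + 2 * η) := by nlinarith
  exact le_of_mul_le_mul_left h6 (by positivity)

/-! ### From votes of the orders to the ratio -/

/-- The orders in `S` in which the index `y` precedes the index `x`. -/
def ordersWithBefore {n : ℕ} (S : Finset (Equiv.Perm (Fin n))) (x y : Fin n) : Finset S :=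
  Finset.univ.filter fun π => π.1.symm y < π.1.symm x

theorem ordersWithBefore_swap {n : ℕ} (S : Finset (Equiv.Perm (Fin n))) (x y : Fin n)
    (hxy : x ≠ y) : ordersWithBefore S y x = (ordersWithBefore S x y)ᶜ := by
  ext π
  have : π.1.symm x ≠ π.1.symm y := fun h => hxy (π.1.symm.injective h)
  simp only [ordersWithBefore, Finset.mem_filter, Finset.mem_univ, true_and, Finset.mem_compl]
  exact ⟨fun h => not_lt.2 h.le, fun h => lt_of_le_of_ne (not_lt.1 h) this⟩

/-- Minimax turns a y depending on the weighting w into one distribution on the indices other than x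
that serves all orders at once. -/
theorem TPR_le_of_forall_vote {n : ℕ} {S : Finset (Equiv.Perm (Fin n))} (hS : S.Nonempty)
    {x : Fin n} {η : ℝ} (hη : 0 ≤ η) (hη1 : η ≤ 1 / 2)
    (h : ∀ w ∈ stdSimplex ℝ S, ∃ y, y ≠ x ∧ 1 / 2 - η ≤ ∑ l ∈ ordersWithBefore S x y, w l) :
    TPR S ≤ ENNReal.ofReal (Real.goldenRatio⁻¹ + 2 * η) := by
  classical
  obtain ⟨π₀, hπ₀⟩ := hS
  obtain ⟨y₀, hy₀, -⟩ := h (Pi.single ⟨π₀, hπ₀⟩ 1) (single_mem_stdSimplex ℝ _)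
  have : Nonempty {y // y ≠ x} := ⟨⟨y₀, hy₀⟩⟩
  obtain ⟨ν, hν, hνS⟩ := exists_mem_stdSimplex_forall_le
    (fun (y : {y // y ≠ x}) (π : S) => if π.1.symm y < π.1.symm x then (1 : ℝ) else 0)
    (1 / 2 - η) (by
      intro w hw
      obtain ⟨y, hy, hle⟩ := h w hw
      refine ⟨⟨y, hy⟩, hle.trans_eq ?_⟩
      rw [ordersWithBefore, Finset.sum_filter]
      exact Finset.sum_congr rfl fun π _ => by simp)
  let μ : Fin n → ℝ := fun y => if hy : y ≠ x then ν ⟨y, hy⟩ else 0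
  have hμν : ∀ y : {y // y ≠ x}, μ y = ν y := fun y => dif_pos y.2
  have hx : μ x = 0 := dif_neg (by simp)
  have hsum : ∀ f : Fin n → ℝ, ∑ y, μ y * f y = ∑ y : {y // y ≠ x}, ν y * f y := by
    intro f
    rw [← Fintype.sum_subtype_add_sum_subtype (fun y => y ≠ x)]
    simp only [hμν]
    rw [add_eq_left]
    refine Finset.sum_eq_zero fun y _ => ?_
    rw [not_not.1 y.2, hx, zero_mul]
  refine TPR_le_of_weights (μ := μ) (x := x) ⟨fun y => ?_, ?_⟩ hx hη hη1 fun π hπ => ?_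
  · by_cases hy : y ≠ x
    · exact (hν.1 ⟨y, hy⟩).trans_eq (hμν ⟨y, hy⟩).symm
    · rw [not_not.1 hy, hx]
  · have := hsum fun _ => 1
    simpa [hν.2] using this
  · refine (hνS ⟨π, hπ⟩).trans_eq ?_
    rw [← hsum fun y => if π.symm y < π.symm x then 1 else 0, Finset.sum_filter]
    exact Finset.sum_congr rfl fun y _ => by simp

theorem TPR_le_of_two_pow_lt {n : ℕ} {S : Finset (Equiv.Perm (Fin n))} (hS : S.Nonempty)
    (hcard : 2 ^ (S.card ^ 2) < n) : TPR S ≤ ENNReal.ofReal Real.goldenRatio⁻¹ := by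
  classical
  have : Nonempty S := hS.to_subtype
  obtain ⟨x, hx⟩ := exists_forall_half_le (ordersWithBefore S) (ordersWithBefore_swap S)
    (by simpa using hcard)
  simpa using TPR_le_of_forall_vote hS (x := x) le_rfl (by norm_num) (by simpa using hx)

theorem TPR_le_add_inv {n : ℕ} {S : Finset (Equiv.Perm (Fin n))} (hS : S.Nonempty) {T : ℕ}
    (hT : 1 ≤ T) (hcard : (3 * (T + 1)) ^ S.card < n) :
    TPR S ≤ ENNReal.ofReal (Real.goldenRatio⁻¹ + 1 / T) := by
  classical
  have : Nonempty S := hS.to_subtype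
  have hT' : (1 : ℝ) ≤ T := by exact_mod_cast hT
  obtain ⟨x, hx⟩ := exists_forall_half_sub_le (ordersWithBefore S) (ordersWithBefore_swap S) T hT
    (by simpa using hcard)
  have h := TPR_le_of_forall_vote hS (x := x) (η := 1 / (2 * T)) (by positivity)
    (by rw [div_le_div_iff_of_pos_left] <;> linarith) hx
  have h2 : 2 * (1 / (2 * T) : ℝ) = 1 / T := by field_simp
  rwa [h2] at h

/-- At η = 1/2 the voting condition only asks for a second index. -/
theorem TPR_le_add_one {n : ℕ} {S : Finset (Equiv.Perm (Fin n))} (hS : S.Nonempty)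
    (hn : 1 < n) : TPR S ≤ ENNReal.ofReal (Real.goldenRatio⁻¹ + 1) := by
  have h := TPR_le_of_forall_vote hS (x := ⟨0, by omega⟩) (η := 1 / 2) (by norm_num) le_rfl
    fun w hw => ⟨⟨1, hn⟩, by simp, by
      rw [sub_self]
      exact Finset.sum_nonneg fun l _ => hw.1 l⟩
  rwa [mul_one_div_cancel two_ne_zero] at h

end ConstrainedOrderProphet

/-! ### Choice of parameters -/

theorem theorem2 :
    (∀ (n : ℕ) (S : Finset (Equiv.Perm (Fin n))), 3 ≤ n → S.Nonempty →
      (S.card : ℝ) < √(Real.logb 2 n) →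
        ConstrainedOrderProphet.TPR S ≤ ENNReal.ofReal Real.goldenRatio⁻¹) ∧
    (∃ C : ℝ, 0 < C ∧
      ∀ (ε : ℝ) (n : ℕ) (S : Finset (Equiv.Perm (Fin n))), 0 < ε → S.Nonempty →
        (S.card : ℝ) < Real.logb (1 / ε) n →
          ConstrainedOrderProphet.TPR S ≤ ENNReal.ofReal (Real.goldenRatio⁻¹ + C * ε)) := by
  refine ⟨fun n S hn hS hcard => ?_, 12, by norm_num, fun ε n S hε hS hcard => ?_⟩
  · refine ConstrainedOrderProphet.TPR_le_of_two_pow_lt hS ?_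
    rw [Real.lt_sqrt (by positivity), Real.lt_logb_iff_rpow_lt (by norm_num) (by positivity)]
      at hcard
    exact_mod_cast hcard
  · have hk : (1 : ℝ) ≤ S.card := by exact_mod_cast hS.card_pos
    have hn : n ≠ 0 := by
      rintro rfl
      simp only [CharP.cast_eq_zero, Real.logb_zero] at hcard
      linarith
    have hn' : (1 : ℝ) ≤ n := by exact_mod_cast Nat.one_le_iff_ne_zero.2 hn
    -- For ε ≥ 1 the logarithm is nonpositive, including ε = 1, where division by log 1 = 0 yields
    -- 0; no non-empty Π qualifies.
    have hε1 : ε < 1 := by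
      by_contra! h
      have h1 : Real.logb (1 / ε) n ≤ 0 := by
        rw [Real.logb]
        refine div_nonpos_of_nonneg_of_nonpos (Real.log_nonneg hn') ?_
        exact Real.log_nonpos (by positivity) (by rw [div_le_one hε]; exact h)
      linarith
    have hbase : 1 < 1 / ε := by rw [lt_div_iff₀ hε]; linarith
    rw [Real.lt_logb_iff_rpow_lt hbase (by linarith), Real.rpow_natCast] at hcard
    -- For ε ≤ 1/6, T = ⌊1/(6ε)⌋ ≥ 1 gives 3(T + 1) ≤ 6/(6ε) = 1/ε, and 1/T ≤ 2/(T + 1) ≤ 12ε. For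
    -- larger ε, 12ε exceeds 1 and the crude bound suffices.
    rcases le_or_gt ε (1 / 6) with hε6 | hε6
    · have h6 : 1 ≤ 1 / (6 * ε) := by rw [le_div_iff₀ (by positivity)]; linarith
      have hT : 1 ≤ ⌊1 / (6 * ε)⌋₊ := Nat.le_floor (by simpa using h6)
      set T := ⌊1 / (6 * ε)⌋₊ with hTdef
      have hT1 : (1 : ℝ) ≤ T := by exact_mod_cast hT
      have hTle : (T : ℝ) ≤ 1 / (6 * ε) := Nat.floor_le (by positivity)
      have hTlt : 1 / (6 * ε) < T + 1 := Nat.lt_floor_add_one _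
      refine (ConstrainedOrderProphet.TPR_le_add_inv hS hT ?_).trans
        (ENNReal.ofReal_le_ofReal ?_)
      · have h3 : (3 * (T + 1) : ℝ) ≤ 1 / ε := by
          have : 1 / ε = 6 * (1 / (6 * ε)) := by field_simp
          linarith
        have h4 : (3 * (T + 1) : ℝ) ^ S.card < n :=
          (pow_le_pow_left₀ (by positivity) h3 _).trans_lt hcard
        exact_mod_cast h4
      · rw [div_lt_iff₀ (by positivity)] at hTlt
        have : 1 / (T : ℝ) ≤ 12 * ε := by
          rw [div_le_iff₀ (by positivity)]
          nlinarith
        linarith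
    · refine (ConstrainedOrderProphet.TPR_le_add_one hS ?_).trans
        (ENNReal.ofReal_le_ofReal (by linarith))
      have : (1 : ℝ) < n := (one_le_pow₀ hbase.le).trans_lt hcard
      exact_mod_cast this
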